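/- Let $G=(V,E)$ be a finite simple graph whose vertex set is partitioned as $V=A\sqcup B$, and suppose $N_B=|B|$ is even. Associate a qubit with each vertex and let $$|G\rangle=\prod_{\{a,b\}\in E}\mathrm{CZ}_{ab}\,|+\rangle^{\otimes |V|},\qquad |+\rangle=\tfrac{1}{\sqrt2}(|0\rangle+|1\rangle),$$ be the graph state of $G$, and $G_B=\mathrm{Tr}_A|G\rangle\langle G|$ its reduced state on $B$. For an $n$-qubit vector $|\psi\rangle$ and an $n$-qubit density matrix $\rho$ put $|\tilde\psi\rangle=\sigma_y^{\otimes n}|\psi^*\rangle$ and $\tilde\rho=\sigma_y^{\otimes n}\rho^*\sigma_y^{\otimes n}$, where $*$ is complex conjugation in the computational basis. Let $\tau_n(|\psi\rangle)=|\langle\psi|\tilde\psi\rangle|$ be the $n$-tangle and $F(\rho,\sigma)=\mathrm{Tr}\sqrt{\sqrt\rho\,\sigma\sqrt\rho}$ the fidelity. Let $\mathbf\Gamma_{BA}\in\mathbb F_2^{B\times A}$ be the block of the adjacency matrix of $G$ with rows in $B$ and columns in $A$, and let $\mathbf D\in\mathbb F_2^B$ be the vector with $\mathbf D_b=1$ if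 $b$ has even degree in the subgraph $G-A$ of $G$ induced by $B$, and $\mathbf D_b=0$ otherwise. A (rank-one projective) measurement on $A$ is an orthonormal basis $(|v_i\rangle)_i$ of the Hilbert space of the qubits in $A$; the basis is arbitrary, so global (entangled) measurements and local ones (all $|v_i\rangle$ product vectors) are both included. Outcome $i$ has probability $p_i=\|(\langle v_i|\otimes I_B)|G\rangle\|^2$ and, if $p_i\neq0$, post-measurement state $|\phi_i\rangle=(\langle v_i|\otimes I_B)|G\rangle/\sqrt{p_i}$ on $B$. Then: 1. If $\mathbf\Gamma_{BA}\mathbf x=\mathbf D$ has a solution $\mathbf x\in\mathbb F_2^A$, then $F(G_B,\tilde G_B)=1$; otherwise $F(G_B,\tilde G_B)=0$. 2. If $\mathbf\Gamma_{BA}\mathbf x=\mathbf D$ has no solution $\mathbf x\in\mathbb F_2^A$, then for every measurement on $A$, local or global, and every outcome $i$ with $p_i\ne0$, $\tau_{N_B}(|\phi_i\rangle)=0$. 3. If $\mathbf\Gamma_{BA}\mathbf x=\mathbf D$ has a solution $\mathbf x\in\mathbb F_2^A$, then there is a measurement on $A$ such that $\tau_{N_B}(|\phi_i\rangle)=1$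 for every outcome $i$ with $p_i\neq0$. -/

import Mathlib

open scoped Matrix MatrixOrder ComplexOrder

noncomputable section

namespace GraphTangle

/-! ### Multi-qubit systems -/

/-- The Hilbert space `(ℂ²)^{⊗ι}` of a collection of qubits labelled by `ι`; coordinates are the
amplitudes in the computational basis, whose elements are the bit strings `ι → Fin 2`. -/
abbrev Qubits (ι : Type*) [Fintype ι] : Type _ := EuclideanSpace ℂ (ι → Fin 2)

/-- Square matrices indexed by the computational basis. -/
abbrev QubitOp (ι : Type*) : Type _ := Matrix (ι → Fin 2) (ι → Fin 2) ℂ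

/-- Application of an operator, given by its computational-basis matrix, to a vector. -/
def applyOp {ι : Type*} [Fintype ι] [DecidableEq ι] (M : QubitOp ι) (ψ : Qubits ι) : Qubits ι :=
  WithLp.toLp 2 (M *ᵥ (fun z => ψ z))

/-- The Pauli matrix `σ_y`. -/
def sigmaY : Matrix (Fin 2) (Fin 2) ℂ := !![0, -Complex.I; Complex.I, 0]

/-- The operator `σ_y^{⊗ι}`. -/
def sigmaYAll (ι : Type*) [Fintype ι] : QubitOp ι :=
  Matrix.of fun x y => ∏ i, sigmaY (x i) (y i)

/-- Wootters' tilde `σ_y^{⊗n} |ψ*⟩` of a vector. -/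
def tildeVec {ι : Type*} [Fintype ι] [DecidableEq ι] (ψ : Qubits ι) : Qubits ι :=
  applyOp (sigmaYAll ι) (WithLp.toLp 2 fun z => star (ψ z))

/-- Wootters' tilde `σ_y^{⊗n} ρ* σ_y^{⊗n}` of a density matrix; `ρ*` is the entrywise conjugate. -/
def tildeOp {ι : Type*} [Fintype ι] [DecidableEq ι] (ρ : QubitOp ι) : QubitOp ι :=
  sigmaYAll ι * ρ.map star * sigmaYAll ι

/-- The `n`-tangle `τ_n(ψ) = |⟨ψ|ψ̃⟩|`, where `n` is the number of labels in `ι`. -/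
def tangle {ι : Type*} [Fintype ι] [DecidableEq ι] (ψ : Qubits ι) : ℝ :=
  ‖inner ℂ ψ (tildeVec ψ)‖

/-- The fidelity `F(ρ, σ) = Tr √(√ρ σ √ρ)`, with square roots of positive semidefinite matrices. -/
def fidelity {ι : Type*} [Fintype ι] [DecidableEq ι] (ρ σ : QubitOp ι) : ℂ :=
  (CFC.sqrt (CFC.sqrt ρ * σ * CFC.sqrt ρ)).trace

/-- The density matrix `|ψ⟩⟨ψ|`. -/
def density {ι : Type*} [Fintype ι] (ψ : Qubits ι) : QubitOp ι :=
  Matrix.of fun x y => ψ x * star (ψ y)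

/-! ### Bipartitions and measurements

The label set `V` is split into a set `A` of measured qubits and its complement `B`. -/

section Bipartite

variable {V : Type*} [Fintype V] [DecidableEq V]

/-- The bit string on `V` that agrees with `x` on `A` and with `y` on the complement of `A`. -/
def glue (A : Finset V) (x : {v // v ∈ A} → Fin 2) (y : {v // v ∉ A} → Fin 2) : V → Fin 2 :=
  fun v => if h : v ∈ A then x ⟨v, h⟩ else y ⟨v, h⟩

/-- The reduced operator on `B` (partial trace over `A`). -/
def reducedB (A : Finset V) (ρ : QubitOp V) : QubitOp {v // v ∉ A} :=
  Matrix.of fun y y' => ∑ x : {v // v ∈ A} → Fin 2, ρ (glue A x y) (glue A x y')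

/-- A rank-one projective (von Neumann) measurement of the qubits in `A`: an arbitrary orthonormal
basis of the Hilbert space of `A`. Its vectors may be entangled; a local measurement is one whose
basis vectors are product vectors. The `2^|A|` outcomes are labelled by bit strings. -/
abbrev Measurement (A : Finset V) : Type _ :=
  OrthonormalBasis ({v // v ∈ A} → Fin 2) ℂ (Qubits {v // v ∈ A})

/-- The vector `(⟨v| ⊗ I_B) |Ψ⟩` on `B`. -/
def contractA (A : Finset V) (v : Qubits {v // v ∈ A}) (Ψ : Qubits V) : Qubits {v // v ∉ A} :=
  WithLp.toLp 2 fun y => ∑ x : {v // v ∈ A} → Fin 2, star (v x) * Ψ (glue A x y)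

/-- The probability `p_i` of outcome `i`. -/
def outcomeProb {A : Finset V} (M : Measurement A) (Ψ : Qubits V) (i : {v // v ∈ A} → Fin 2) : ℝ :=
  ‖contractA A (M i) Ψ‖ ^ 2

/-- The state `(⟨v_i| ⊗ I_B) |Ψ⟩ / √p_i` left on `B` after outcome `i` (meaningful for `p_i ≠ 0`). -/
def postState {A : Finset V} (M : Measurement A) (Ψ : Qubits V) (i : {v // v ∈ A} → Fin 2) :
    Qubits {v // v ∉ A} :=
  ((√(outcomeProb M Ψ i))⁻¹ : ℂ) • contractA A (M i) Ψ

end Bipartite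

/-! ### Graph states -/

section Graph

variable {V : Type*} [Fintype V] [DecidableEq V]

/-- The controlled-Z gate on the pair of qubits `e`: sign `-1` on the basis states in which
both qubits of `e` are `1`. -/
def CZ (e : Sym2 V) : QubitOp V :=
  Matrix.diagonal fun z => if ∀ v ∈ e, z v = 1 then -1 else 1

theorem CZ_commute (e f : Sym2 V) : Commute (CZ e) (CZ f) := by
  unfold CZ
  rw [Commute, SemiconjBy, Matrix.diagonal_mul_diagonal, Matrix.diagonal_mul_diagonal]
  simp only [mul_comm]

/-- The state `|+⟩^{⊗V}`, where `|+⟩ = (|0⟩ + |1⟩)/√2`. -/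
def plusAll (V : Type*) [Fintype V] : Qubits V :=
  WithLp.toLp 2 fun _ => ∏ _v : V, (1 / (√2 : ℂ))

/-- The graph state `|G⟩ = ∏_{e ∈ E} CZ_e |+⟩^{⊗V}`. -/
def graphState (G : SimpleGraph V) [DecidableRel G.Adj] : Qubits V :=
  applyOp (G.edgeFinset.noncommProd (fun e => CZ e) fun e _ f _ _ => CZ_commute e f) (plusAll V)

/-- The block `Γ_BA` of the adjacency matrix over `𝔽₂`, with rows in `B` and columns in `A`. -/
def gammaBA (G : SimpleGraph V) [DecidableRel G.Adj] (A : Finset V) :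
    Matrix {v // v ∉ A} {v // v ∈ A} (ZMod 2) :=
  (G.adjMatrix (ZMod 2)).submatrix (fun b => b.1) (fun a => a.1)

/-- The degree vector `D` of `G - A`: `D_b = 1` iff `b` has even degree in the subgraph of `G`
induced by the complement of `A`. -/
def degreeVec (G : SimpleGraph V) [DecidableRel G.Adj] (A : Finset V) : {v // v ∉ A} → ZMod 2 :=
  fun b => if Even ((G.induce {v | v ∉ A}).degree b) then 1 else 0

end Graph

end GraphTangle

end

/-!
Expanding the measured qubits in the computational basis gives
`|G⟩ = ∑_x ⟨x|G[A]⟩ |x⟩ ⊗ Z^{Γ_BA x} |G - A⟩`, and the vectors `Z^u |G - A⟩` form an orthonormal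
basis, the graph basis of `B`. Since `σ_y` flips every qubit, polarizing the quadratic form in the
exponent of the amplitudes shows that the tilde operation maps `Z^u |G - A⟩` to a phase times
`Z^{u + D} |G - A⟩`.

If `Γ_BA x₀ = D`, the tilde thus maps the branch `x` to a phase times the branch `x + x₀`, so `G_B`
is its own tilde and the fidelity is `Tr G_B = 1`. Otherwise every branch is orthogonal to the
tilde of every branch, so `G_B` annihilates its tilde and all tangles vanish.

For the optimal measurement in the solvable case, twist the graph basis of `G[A]` by the phases
`i^{1ᵀ Γ_BA x}`, with exponent reduced to `0` or `1`. The shift `x ↦ x + x₀` does not change them: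
`1ᵀ D ≡ |B|` modulo `2` by the handshake lemma, and `|B|` is even. Hence every post-measurement
state is a unit multiple of its own tilde.
-/

namespace GraphTangle

open scoped Fin.CommRing

/-! ### Characters of bit strings -/

/-- The sign character `b ↦ (-1)^b` of the additive group of bits. -/
def bitSign : AddChar (Fin 2) ℂ where
  toFun b := (-1) ^ (b : ℕ)
  map_zero_eq_one' := by simp
  map_add_eq_mul' a b := by fin_cases a <;> fin_cases b <;> simp

theorem bitSign_one : bitSign 1 = -1 := by simp [bitSign]

@[simp] theorem star_bitSign (b : Fin 2) : star (bitSign b) = bitSign b := by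
  simp [bitSign]

@[simp] theorem bitSign_mul_self (b : Fin 2) : bitSign b * bitSign b = 1 := by
  rw [← AddChar.map_add_eq_mul, CharTwo.add_self_eq_zero, AddChar.map_zero_eq_one]

theorem bitSign_sum {ι : Type*} (s : Finset ι) (f : ι → Fin 2) :
    bitSign (∑ i ∈ s, f i) = ∏ i ∈ s, bitSign (f i) :=
  map_sum bitSign.toAddMonoidHom f s

theorem sum_bitSign_dotProduct {ι : Type*} [Fintype ι] [DecidableEq ι] (u : ι → Fin 2) :
    ∑ y : ι → Fin 2, bitSign (u ⬝ᵥ y) = if u = 0 then 2 ^ Fintype.card ι else 0 := by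
  let χ : AddChar (ι → Fin 2) ℂ :=
    bitSign.compAddMonoidHom (dotProductEquiv (Fin 2) ι u).toAddMonoidHom
  have χ_eq_zero_iff : χ = 0 ↔ u = 0 := by
    refine ⟨fun h => funext fun i => ?_, by rintro rfl; ext; simp [χ]⟩
    have hi : bitSign (u i) = 1 := by simpa [χ] using DFunLike.congr_fun h (Pi.single i 1)
    by_contra hne
    rw [Fin.eq_one_of_ne_zero _ hne, bitSign_one] at hi
    norm_num at hi
  classical
  calc ∑ y, bitSign (u ⬝ᵥ y) = ∑ y, χ y := rfl
    _ = _ := by rw [AddChar.sum_eq_ite]; simp [χ_eq_zero_iff]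

/-! ### The edge form of a graph -/

section EdgeForm

variable {V : Type*} [Fintype V]

/-- The quadratic form `z ↦ ∑_{ij ∈ E} z_i z_j` of a graph over the field of two elements; it is
the exponent of `-1` in the amplitudes of the graph state. -/
def edgeForm (G : SimpleGraph V) [DecidableRel G.Adj] (z : V → Fin 2) : Fin 2 :=
  ∑ e ∈ G.edgeFinset, (e.map z).mul

theorem sum_edgeFinset_eq_sum_sum_adj (G : SimpleGraph V) [DecidableRel G.Adj] {M : Type*}
    [AddCommMonoid M] (f : Sym2 V → M) (g : V → V → M) (hfg : ∀ i j, f s(i, j) = g i j + g j i) :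
    ∑ e ∈ G.edgeFinset, f e = ∑ i, ∑ j, if G.Adj i j then g i j else 0 := by
  classical
  let arcs : Finset (V × V) := {p | G.Adj p.1 p.2}
  have hmaps : ∀ p ∈ arcs, Sym2.mk p.1 p.2 ∈ G.edgeFinset := by simp [arcs]
  have hfiber {i j : V} (hij : G.Adj i j) :
      {p ∈ arcs | s(p.1, p.2) = s(i, j)} = {(i, j), (j, i)} := by
    ext ⟨k, l⟩
    simp only [arcs, Finset.mem_filter, Finset.mem_univ, true_and, Sym2.eq_iff, Finset.mem_insert,
      Finset.mem_singleton, Prod.mk.injEq, and_iff_right_iff_imp]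
    rintro (⟨rfl, rfl⟩ | ⟨rfl, rfl⟩)
    exacts [hij, hij.symm]
  rw [← Fintype.sum_prod_type' (f := fun i j => if G.Adj i j then g i j else 0),
    ← Finset.sum_filter, ← Finset.sum_fiberwise_of_maps_to hmaps]
  refine Finset.sum_congr rfl fun e he => ?_
  induction e using Sym2.ind with
  | _ i j =>
    have hij : G.Adj i j := by simpa using he
    rw [hfiber hij, Finset.sum_pair (by simp [hij.ne]), hfg]

theorem edgeForm_add (G : SimpleGraph V) [DecidableRel G.Adj] (z w : V → Fin 2) :
    edgeForm G (z + w) =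
      edgeForm G z + edgeForm G w + z ⬝ᵥ G.adjMatrix (Fin 2) *ᵥ w := by
  classical
  rw [SimpleGraph.dotProduct_mulVec_adjMatrix, ← sum_edgeFinset_eq_sum_sum_adj G
    fun e => (e.map (z + w)).mul - (e.map z).mul - (e.map w).mul]
  · simp only [edgeForm, Finset.sum_sub_distrib]
    ring
  · intro i j
    simp only [Sym2.map_mk, Sym2.mul_mk, Pi.add_apply]
    ring

theorem edgeForm_comap {W : Type*} [Fintype W] (G : SimpleGraph V) [DecidableRel G.Adj]
    (f : W ↪ V) {z : V → Fin 2} (hz : ∀ v ∉ Set.range f, z v = 0) :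
    edgeForm (G.comap f) (z ∘ f) = edgeForm G z := by
  refine Finset.sum_of_injOn (Sym2.map f) (Sym2.map.injective f.injective).injOn ?_ ?_ ?_
  · intro e
    induction e using Sym2.ind with | _ i j => simp
  · intro e
    induction e using Sym2.ind with | _ i j =>
    intro he hne
    rw [Sym2.map_mk, Sym2.mul_mk]
    by_cases hi : i ∈ Set.range f
    · by_cases hj : j ∈ Set.range f
      · obtain ⟨k, rfl⟩ := hi
        obtain ⟨l, rfl⟩ := hj
        exact absurd ⟨s(k, l), by simpa using he, rfl⟩ hne
      · rw [hz j hj, mul_zero]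
    · rw [hz i hi, zero_mul]
  · intro e _
    rw [Sym2.map_map]

end EdgeForm

/-! ### Graph states -/

section GraphState

variable {V : Type*} [Fintype V] [DecidableEq V] (G : SimpleGraph V) [DecidableRel G.Adj]

theorem CZ_eq_diagonal (e : Sym2 V) :
    CZ e = Matrix.diagonal fun z => bitSign (e.map z).mul := by
  rw [CZ]
  congr with z
  induction e using Sym2.ind with
  | _ i j =>
    simp only [Sym2.mem_iff, forall_eq_or_imp, forall_eq, Sym2.map_mk, Sym2.mul_mk]
    generalize z i = a, z j = b
    fin_cases a <;> fin_cases b <;> simp [bitSign_one]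

theorem noncommProd_CZ (s : Finset (Sym2 V))
    (hs : (s : Set (Sym2 V)).Pairwise (Function.onFun Commute CZ)) :
    s.noncommProd CZ hs = Matrix.diagonal fun z => bitSign (∑ e ∈ s, (e.map z).mul) := by
  induction s using Finset.induction_on with
  | empty => simp
  | insert e s he ih =>
    rw [Finset.noncommProd_insert_of_notMem _ _ _ _ he, ih, CZ_eq_diagonal,
      Matrix.diagonal_mul_diagonal]
    simp only [Finset.sum_insert he, AddChar.map_add_eq_mul]

theorem graphState_apply (z : V → Fin 2) :
    graphState G z = (√2 : ℂ)⁻¹ ^ Fintype.card V * bitSign (edgeForm G z) := by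
  have h : graphState G =
      applyOp (Matrix.diagonal fun z => bitSign (edgeForm G z)) (plusAll V) :=
    congrArg (applyOp · (plusAll V)) (noncommProd_CZ _ _)
  simp [h, applyOp, Matrix.mulVec_diagonal, plusAll, mul_comm]

@[simp] theorem star_graphState (z : V → Fin 2) : star (graphState G z) = graphState G z := by
  rw [graphState_apply, star_mul', star_bitSign, star_pow, star_inv₀, Complex.star_def,
    Complex.conj_ofReal]

theorem graphState_eq_bitSign_mul (z w : V → Fin 2) :
    graphState G z = bitSign (edgeForm G z + edgeForm G w) * graphState G w := by
  rw [graphState_apply, graphState_apply, mul_left_comm, AddChar.map_add_eq_mul, mul_assoc,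
    bitSign_mul_self, mul_one]

theorem graphState_mul_self (z : V → Fin 2) :
    graphState G z * graphState G z = (2 ^ Fintype.card V)⁻¹ := by
  have h : (√2 : ℂ) * √2 = 2 := by
    exact_mod_cast Real.mul_self_sqrt zero_le_two
  rw [graphState_apply, mul_mul_mul_comm, bitSign_mul_self, mul_one, ← mul_pow, ← mul_inv, h,
    inv_pow]

end GraphState

/-! ### The tilde operation -/

section Tilde

variable {ι : Type*} [Fintype ι]

theorem sigmaY_apply (a b : Fin 2) :
    sigmaY a b = if b = a + 1 then -Complex.I * bitSign a else 0 := by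
  fin_cases a <;> fin_cases b <;> simp [sigmaY, bitSign_one]

theorem sigmaYAll_apply (y w : ι → Fin 2) :
    sigmaYAll ι y w =
      if w = y + 1 then (-Complex.I) ^ Fintype.card ι * bitSign (∑ i, y i) else 0 := by
  simp only [sigmaYAll, Matrix.of_apply, sigmaY_apply]
  split_ifs with h
  · simp [h, Finset.prod_mul_distrib, bitSign_sum, -neg_mul]
  · obtain ⟨i, hi⟩ := Function.ne_iff.1 h
    exact Finset.prod_eq_zero (Finset.mem_univ i) (if_neg hi)

theorem isHermitian_sigmaYAll : (sigmaYAll ι).IsHermitian := by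
  have isHermitian_sigmaY : sigmaY.IsHermitian := by
    ext a b
    fin_cases a <;> fin_cases b <;> simp [sigmaY]
  ext y w
  simp only [sigmaYAll, Matrix.conjTranspose_apply, Matrix.of_apply, star_prod,
    isHermitian_sigmaY.apply]

theorem density_eq_vecMulVec (ψ : Qubits ι) : density ψ = Matrix.vecMulVec ψ (star ψ) := rfl

variable [DecidableEq ι]

theorem tildeVec_apply (ψ : Qubits ι) (y : ι → Fin 2) :
    tildeVec ψ y =
      (-Complex.I) ^ Fintype.card ι * bitSign (∑ i, y i) * star (ψ (y + 1)) := by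
  simp [tildeVec, applyOp, Matrix.mulVec, dotProduct, sigmaYAll_apply]

theorem tildeVec_smul (c : ℂ) (ψ : Qubits ι) : tildeVec (c • ψ) = star c • tildeVec ψ := by
  ext y
  simp only [tildeVec_apply, PiLp.smul_apply, smul_eq_mul, star_mul']
  ring

theorem tildeVec_sum {κ : Type*} (s : Finset κ) (φ : κ → Qubits ι) :
    tildeVec (∑ k ∈ s, φ k) = ∑ k ∈ s, tildeVec (φ k) := by
  ext y
  simp [tildeVec_apply, Finset.mul_sum]

theorem tildeOp_sum {κ : Type*} (s : Finset κ) (ρ : κ → QubitOp ι) :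
    tildeOp (∑ k ∈ s, ρ k) = ∑ k ∈ s, tildeOp (ρ k) := by
  have hstar : (∑ k ∈ s, ρ k).map star = ∑ k ∈ s, (ρ k).map star := by
    ext
    simp [Matrix.sum_apply]
  simp only [tildeOp, hstar, Finset.mul_sum, Finset.sum_mul]

theorem tildeOp_density (ψ : Qubits ι) : tildeOp (density ψ) = density (tildeVec ψ) := by
  have hconj : (density ψ).map star = Matrix.vecMulVec (star ψ) ψ := by
    ext
    simp [density, Matrix.vecMulVec_apply]
  have hbra : (ψ : (ι → Fin 2) → ℂ) ᵥ* sigmaYAll ι = star (sigmaYAll ι *ᵥ star ψ) := by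
    rw [Matrix.star_mulVec, star_star, isHermitian_sigmaYAll.eq]
  rw [tildeOp, hconj, Matrix.mul_vecMulVec, Matrix.vecMulVec_mul, hbra]
  rfl

theorem tildeVec_sum_smul_of_perm {κ : Type*} [Fintype κ] {φ : κ → Qubits ι} (e : Equiv.Perm κ)
    {a c : κ → ℂ} {γ : ℂ} (hφ : ∀ k, tildeVec (φ k) = c k • φ (e k))
    (ha : ∀ k, star (a k) * c k = γ * a (e k)) :
    tildeVec (∑ k, a k • φ k) = γ • ∑ k, a k • φ k := by
  simp only [tildeVec_sum, tildeVec_smul, hφ, smul_smul, ha, Finset.smul_sum]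
  exact Equiv.sum_comp e fun k => (γ * a k) • φ k

theorem tangle_smul (c : ℂ) (ψ : Qubits ι) : tangle (c • ψ) = ‖c‖ ^ 2 * tangle ψ := by
  simp only [tangle, tildeVec_smul, inner_smul_left, inner_smul_right, norm_mul, norm_star,
    RCLike.norm_conj]
  ring

theorem tangle_eq_norm_sq_of_tildeVec_eq_smul {ψ : Qubits ι} {c : ℂ} (hc : ‖c‖ = 1)
    (h : tildeVec ψ = c • ψ) : tangle ψ = ‖ψ‖ ^ 2 := by
  simp [tangle, h, hc]

theorem tangle_sum_smul_eq_zero {κ : Type*} [Fintype κ] {φ : κ → Qubits ι}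
    (hφ : ∀ j k, inner ℂ (φ j) (tildeVec (φ k)) = 0) (c : κ → ℂ) :
    tangle (∑ k, c k • φ k) = 0 := by
  simp [tangle, tildeVec_sum, tildeVec_smul, hφ]

end Tilde

/-! ### Density matrices and fidelity -/

section Fidelity

variable {ι κ : Type*} [Fintype ι] [Fintype κ]

theorem density_nonneg (ψ : Qubits ι) : 0 ≤ density ψ := by
  classical
  exact (Matrix.posSemidef_vecMulVec_self_star (ψ : (ι → Fin 2) → ℂ)).nonneg

theorem density_smul {c : ℂ} (hc : ‖c‖ = 1) (ψ : Qubits ι) : density (c • ψ) = density ψ := by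
  have hcc : c * star c = 1 := by simp [Complex.mul_conj, Complex.normSq_eq_norm_sq, hc]
  ext y w
  simp only [density, Matrix.of_apply, PiLp.smul_apply, smul_eq_mul, star_mul']
  linear_combination ψ y * star (ψ w) * hcc

variable [DecidableEq ι]

theorem trace_density (ψ : Qubits ι) : (density ψ).trace = ‖ψ‖ ^ 2 := by
  rw [density_eq_vecMulVec, Matrix.trace_vecMulVec, ← EuclideanSpace.inner_eq_star_dotProduct,
    inner_self_eq_norm_sq_to_K]
  rfl

theorem density_mul_density_eq_zero {φ ψ : Qubits ι} (h : inner ℂ φ ψ = 0) :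
    density φ * density ψ = 0 := by
  rw [EuclideanSpace.inner_eq_star_dotProduct, dotProduct_comm] at h
  rw [density_eq_vecMulVec, density_eq_vecMulVec, Matrix.vecMulVec_mul_vecMulVec]
  simp [h]

theorem fidelity_self {ρ : QubitOp ι} (hρ : 0 ≤ ρ) : fidelity ρ ρ = ρ.trace := by
  have hsq : CFC.sqrt ρ * CFC.sqrt ρ = ρ := CFC.sqrt_mul_sqrt_self ρ hρ
  have h : CFC.sqrt ρ * ρ * CFC.sqrt ρ = ρ * ρ := by
    calc CFC.sqrt ρ * ρ * CFC.sqrt ρ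
        = CFC.sqrt ρ * (CFC.sqrt ρ * CFC.sqrt ρ) * CFC.sqrt ρ := by rw [hsq]
      _ = (CFC.sqrt ρ * CFC.sqrt ρ) * (CFC.sqrt ρ * CFC.sqrt ρ) := by simp only [mul_assoc]
      _ = ρ * ρ := by rw [hsq]
  rw [fidelity, h, CFC.sqrt_mul_self ρ hρ]

theorem fidelity_eq_zero_of_mul_eq_zero {ρ σ : QubitOp ι} (hρ : 0 ≤ ρ) (h : ρ * σ = 0) :
    fidelity ρ σ = 0 := by
  have hsqrt : (CFC.sqrt ρ)ᴴ = CFC.sqrt ρ := (CFC.sqrt_nonneg ρ).isSelfAdjoint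
  have h0 : CFC.sqrt ρ * σ = 0 := by
    rw [← Matrix.conjTranspose_mul_self_mul_eq_zero, hsqrt, CFC.sqrt_mul_sqrt_self ρ hρ, h]
  rw [fidelity, h0, zero_mul, CFC.sqrt_zero, Matrix.trace_zero]

theorem fidelity_tildeOp_sum_density_eq_zero {φ : κ → Qubits ι}
    (hφ : ∀ j k, inner ℂ (φ j) (tildeVec (φ k)) = 0) :
    fidelity (∑ k, density (φ k)) (tildeOp (∑ k, density (φ k))) = 0 := by
  refine fidelity_eq_zero_of_mul_eq_zero (Finset.sum_nonneg fun k _ => density_nonneg _) ?_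
  simp [tildeOp_sum, tildeOp_density, Finset.sum_mul_sum, density_mul_density_eq_zero, hφ]

theorem fidelity_tildeOp_sum_density_of_perm {φ : κ → Qubits ι} (e : Equiv.Perm κ) (c : κ → ℂ)
    (hc : ∀ k, ‖c k‖ = 1) (hφ : ∀ k, tildeVec (φ k) = c k • φ (e k)) :
    fidelity (∑ k, density (φ k)) (tildeOp (∑ k, density (φ k))) = ∑ k, (‖φ k‖ ^ 2 : ℂ) := by
  have htilde : tildeOp (∑ k, density (φ k)) = ∑ k, density (φ k) := by
    simp only [tildeOp_sum, tildeOp_density, hφ, density_smul (hc _)]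
    exact Equiv.sum_comp e fun k => density (φ k)
  rw [htilde, fidelity_self (Finset.sum_nonneg fun k _ => density_nonneg _), Matrix.trace_sum]
  simp only [trace_density]

end Fidelity

/-! ### The graph basis -/

section GraphBasis

variable {ι : Type*} [Fintype ι]

/-- The parity vector with `D_b = 1` iff `b` has even degree; `degreeVec G A` is this vector for
the subgraph of `G` induced by the complement of `A`. -/
def evenDegreeVec (H : SimpleGraph ι) [DecidableRel H.Adj] : ι → Fin 2 :=
  fun b => if Even (H.degree b) then 1 else 0

theorem evenDegreeVec_eq (H : SimpleGraph ι) [DecidableRel H.Adj] :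
    evenDegreeVec H = 1 + H.adjMatrix (Fin 2) *ᵥ 1 := by
  funext b
  have hdeg : (H.adjMatrix (Fin 2) *ᵥ 1) b = H.degree b := by
    simp [SimpleGraph.adjMatrix_mulVec_apply]
  rw [Pi.add_apply, hdeg, evenDegreeVec, CharTwo.natCast_eq_ite]
  split_ifs <;> rfl

theorem one_dotProduct_evenDegreeVec (H : SimpleGraph ι) [DecidableRel H.Adj] :
    1 ⬝ᵥ evenDegreeVec H = (Fintype.card ι : Fin 2) := by
  have hshake : H.adjMatrix (Fin 2) *ᵥ 1 ⬝ᵥ 1 = (2 * H.edgeFinset.card : ℕ) := by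
    rw [← H.dart_card_eq_twice_card_edges]
    exact H.natCast_card_dart_eq_dotProduct.symm
  rw [evenDegreeVec_eq, dotProduct_add, one_dotProduct_one, dotProduct_comm, hshake, Nat.cast_mul,
    CharP.cast_eq_zero (Fin 2) 2, zero_mul, add_zero]

variable [DecidableEq ι]

/-- The vector `Z^u |ψ⟩`, in which the Pauli operator `σ_z` acts on the qubits `i` with `u_i = 1`.
For a graph state `|ψ⟩` these vectors form the graph basis. -/
def phaseFlip (u : ι → Fin 2) (ψ : Qubits ι) : Qubits ι :=
  WithLp.toLp 2 fun y => bitSign (u ⬝ᵥ y) * ψ y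

theorem orthonormal_phaseFlip {ψ : Qubits ι}
    (hψ : ∀ y, star (ψ y) * ψ y = (2 ^ Fintype.card ι)⁻¹) :
    Orthonormal ℂ fun u => phaseFlip u ψ := by
  rw [orthonormal_iff_ite]
  intro u v
  have hterm (y : ι → Fin 2) : inner ℂ (phaseFlip u ψ y) (phaseFlip v ψ y) =
      (2 ^ Fintype.card ι)⁻¹ * bitSign ((u - v) ⬝ᵥ y) := by
    rw [RCLike.inner_apply', starRingEnd_apply, ← hψ y, sub_dotProduct, CharTwo.sub_eq_add,
      AddChar.map_add_eq_mul]
    simp only [phaseFlip, star_mul', star_bitSign]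
    ring
  simp only [PiLp.inner_apply, hterm, ← Finset.mul_sum, sum_bitSign_dotProduct, sub_eq_zero]
  simp

theorem orthonormal_phaseFlip_graphState (H : SimpleGraph ι) [DecidableRel H.Adj] :
    Orthonormal ℂ fun u => phaseFlip u (graphState H) :=
  orthonormal_phaseFlip fun y => by rw [star_graphState, graphState_mul_self]

theorem norm_graphState (H : SimpleGraph ι) [DecidableRel H.Adj] : ‖graphState H‖ = 1 := by
  simpa [phaseFlip] using (orthonormal_phaseFlip_graphState H).norm_eq_one 0

theorem tildeVec_phaseFlip_graphState (H : SimpleGraph ι) [DecidableRel H.Adj] (u : ι → Fin 2) :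
    tildeVec (phaseFlip u (graphState H)) =
      ((-Complex.I) ^ Fintype.card ι * bitSign (edgeForm H 1 + 1 ⬝ᵥ u)) •
        phaseFlip (u + evenDegreeVec H) (graphState H) := by
  ext y
  have hflip : (∑ i, y i) + edgeForm H (y + 1) =
      edgeForm H 1 + edgeForm H y + evenDegreeVec H ⬝ᵥ y := by
    rw [evenDegreeVec_eq, edgeForm_add, add_dotProduct, one_dotProduct, dotProduct_comm y]
    ring
  have hsign := congrArg bitSign hflip
  simp only [AddChar.map_add_eq_mul] at hsign
  simp only [tildeVec_apply, phaseFlip, PiLp.smul_apply, smul_eq_mul, star_mul', star_bitSign,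
    star_graphState]
  simp only [graphState_apply, dotProduct_add, add_dotProduct, AddChar.map_add_eq_mul,
    dotProduct_comm 1 u]
  linear_combination (-Complex.I) ^ Fintype.card ι * bitSign (u ⬝ᵥ y) * bitSign (u ⬝ᵥ 1) *
    (√2 : ℂ)⁻¹ ^ Fintype.card ι * hsign

end GraphBasis

/-! ### Bipartitions -/

section Bipartite

variable {V : Type*} [DecidableEq V] (A : Finset V)

@[simp] theorem glue_mem (x : {v // v ∈ A} → Fin 2) (y : {v // v ∉ A} → Fin 2)
    (a : {v // v ∈ A}) : glue A x y a = x a :=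
  dif_pos a.2

@[simp] theorem glue_notMem (x : {v // v ∈ A} → Fin 2) (y : {v // v ∉ A} → Fin 2)
    (b : {v // v ∉ A}) : glue A x y b = y b :=
  dif_neg b.2

variable [Fintype V]

/-- The unnormalised state `(⟨x| ⊗ I_B) |Ψ⟩` of `B` belonging to the computational basis state `x`
of `A`. -/
def branch (Ψ : Qubits V) (x : {v // v ∈ A} → Fin 2) : Qubits {v // v ∉ A} :=
  WithLp.toLp 2 fun y => Ψ (glue A x y)

theorem reducedB_density (Ψ : Qubits V) :
    reducedB A (density Ψ) = ∑ x, density (branch A Ψ x) := by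
  ext y w
  simp [reducedB, density, branch, Matrix.sum_apply]

theorem contractA_eq_sum_branch (v : Qubits {v // v ∈ A}) (Ψ : Qubits V) :
    contractA A v Ψ = ∑ x, star (v x) • branch A Ψ x := by
  ext y
  simp [contractA, branch]

variable {A} in
theorem tangle_postState (M : Measurement A) (Ψ : Qubits V) (i : {v // v ∈ A} → Fin 2) :
    tangle (postState M Ψ i) = (outcomeProb M Ψ i)⁻¹ * tangle (contractA A (M i) Ψ) := by
  have hp : 0 ≤ outcomeProb M Ψ i := sq_nonneg _
  rw [postState, tangle_smul, norm_inv, inv_pow, Complex.norm_real, Real.norm_eq_abs, sq_abs,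
    Real.sq_sqrt hp]

variable (G : SimpleGraph V) [DecidableRel G.Adj]

/-- The subgraph of `G` induced by `A`. -/
abbrev graphOn : SimpleGraph {v // v ∈ A} := G.comap (Function.Embedding.subtype (· ∈ A))

/-- The subgraph `G - A` of `G` induced by the complement of `A`. -/
abbrev graphOff : SimpleGraph {v // v ∉ A} := G.comap (Function.Embedding.subtype (· ∉ A))

/-- The block `Γ_BA` of the adjacency matrix with entries in the type of bits, so that it acts on
the labels of computational basis states; compare `gammaBA`, with entries in `ZMod 2`. -/
def crossAdj : Matrix {v // v ∉ A} {v // v ∈ A} (Fin 2) :=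
  (G.adjMatrix (Fin 2)).submatrix Subtype.val Subtype.val

/- `Fin 2` with its modular ring structure is definitionally `ZMod 2`. -/
theorem exists_gammaBA_mulVec_eq_degreeVec_iff :
    (∃ x : {v // v ∈ A} → ZMod 2, gammaBA G A *ᵥ x = degreeVec G A) ↔
      ∃ x, crossAdj A G *ᵥ x = evenDegreeVec (graphOff A G) := by
  have hdeg : degreeVec G A = evenDegreeVec (graphOff A G) := by
    funext b
    rw [degreeVec, evenDegreeVec]
    congr!
  rw [hdeg]
  exact Iff.rfl

theorem edgeForm_glue (x : {v // v ∈ A} → Fin 2) (y : {v // v ∉ A} → Fin 2) :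
    edgeForm G (glue A x y) =
      edgeForm (graphOn A G) x + edgeForm (graphOff A G) y + crossAdj A G *ᵥ x ⬝ᵥ y := by
  have hglue : glue A x y = glue A 0 y + glue A x 0 := by
    funext v
    by_cases hv : v ∈ A <;> simp [glue, hv]
  have hcross : glue A 0 y ⬝ᵥ G.adjMatrix (Fin 2) *ᵥ glue A x 0 = crossAdj A G *ᵥ x ⬝ᵥ y := by
    simp only [dotProduct, Matrix.mulVec, ← Fintype.sum_subtype_add_sum_subtype (· ∈ A),
      glue_mem, glue_notMem, Pi.zero_apply, zero_mul, mul_zero, Finset.sum_const_zero, zero_add,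
      add_zero, crossAdj, Matrix.submatrix_apply, mul_comm (y _)]
    congr!
  have hon : edgeForm G (glue A x 0) = edgeForm (graphOn A G) x := by
    have hx : glue A x 0 ∘ Function.Embedding.subtype (· ∈ A) = x := by ext; simp
    rw [← edgeForm_comap G (.subtype (· ∈ A)) (by simp +contextual [glue]), hx]
  have hoff : edgeForm G (glue A 0 y) = edgeForm (graphOff A G) y := by
    have hy : glue A 0 y ∘ Function.Embedding.subtype (· ∉ A) = y := by ext; simp
    rw [← edgeForm_comap G (.subtype (· ∉ A)) (by simp +contextual [glue]), hy]
  rw [hglue, edgeForm_add, hcross, hon, hoff, add_comm (edgeForm (graphOn A G) x)]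

theorem branch_graphState (x : {v // v ∈ A} → Fin 2) :
    branch A (graphState G) x =
      graphState (graphOn A G) x • phaseFlip (crossAdj A G *ᵥ x) (graphState (graphOff A G)) := by
  ext y
  have hcard : Fintype.card V = Fintype.card {v // v ∈ A} + Fintype.card {v // v ∉ A} := by
    rw [← Fintype.card_sum]
    exact (Fintype.card_congr (Equiv.sumCompl (· ∈ A))).symm
  simp only [branch, phaseFlip, PiLp.smul_apply, smul_eq_mul, graphState_apply, edgeForm_glue,
    AddChar.map_add_eq_mul, hcard, pow_add]
  ring

theorem tildeVec_branch_graphState (x : {v // v ∈ A} → Fin 2) :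
    tildeVec (branch A (graphState G) x) =
      (graphState (graphOn A G) x * ((-Complex.I) ^ Fintype.card {v // v ∉ A} *
        bitSign (edgeForm (graphOff A G) 1 + 1 ⬝ᵥ crossAdj A G *ᵥ x))) •
        phaseFlip (crossAdj A G *ᵥ x + evenDegreeVec (graphOff A G))
          (graphState (graphOff A G)) := by
  rw [branch_graphState, tildeVec_smul, tildeVec_phaseFlip_graphState, star_graphState, smul_smul]

theorem sum_norm_sq_branch_graphState : ∑ x, ‖branch A (graphState G) x‖ ^ 2 = 1 := by
  simp only [branch_graphState, norm_smul, (orthonormal_phaseFlip_graphState _).norm_eq_one,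
    mul_one]
  rw [← EuclideanSpace.norm_sq_eq, norm_graphState, one_pow]

theorem inner_branch_tildeVec_branch_eq_zero
    (h : ¬ ∃ x, crossAdj A G *ᵥ x = evenDegreeVec (graphOff A G)) (x x' : {v // v ∈ A} → Fin 2) :
    inner ℂ (branch A (graphState G) x) (tildeVec (branch A (graphState G) x')) = 0 := by
  have hne : crossAdj A G *ᵥ x ≠ crossAdj A G *ᵥ x' + evenDegreeVec (graphOff A G) :=
    fun heq => h ⟨x - x', by rw [Matrix.mulVec_sub, heq, add_sub_cancel_left]⟩
  rw [tildeVec_branch_graphState, branch_graphState, inner_smul_left, inner_smul_right,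
    (orthonormal_phaseFlip_graphState _).inner_eq_zero hne, mul_zero, mul_zero]

theorem fidelity_reducedB_graphState_eq_zero
    (h : ¬ ∃ x, crossAdj A G *ᵥ x = evenDegreeVec (graphOff A G)) :
    fidelity (reducedB A (density (graphState G)))
      (tildeOp (reducedB A (density (graphState G)))) = 0 := by
  rw [reducedB_density]
  exact fidelity_tildeOp_sum_density_eq_zero (inner_branch_tildeVec_branch_eq_zero A G h)

theorem tangle_postState_graphState_eq_zero
    (h : ¬ ∃ x, crossAdj A G *ᵥ x = evenDegreeVec (graphOff A G)) (M : Measurement A)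
    (i : {v // v ∈ A} → Fin 2) : tangle (postState M (graphState G) i) = 0 := by
  rw [tangle_postState, contractA_eq_sum_branch,
    tangle_sum_smul_eq_zero (inner_branch_tildeVec_branch_eq_zero A G h), mul_zero]

/-- The phase relating the tilde of the branch `x` of a graph state to the branch `x + x₀`, where
`Γ_BA x₀ = D`. -/
def branchPhase (x₀ x : {v // v ∈ A} → Fin 2) : ℂ :=
  (-Complex.I) ^ Fintype.card {v // v ∉ A} *
    bitSign (edgeForm (graphOff A G) 1 + 1 ⬝ᵥ crossAdj A G *ᵥ x +
      (edgeForm (graphOn A G) x + edgeForm (graphOn A G) (x + x₀)))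

theorem norm_branchPhase (x₀ x : {v // v ∈ A} → Fin 2) : ‖branchPhase A G x₀ x‖ = 1 := by
  simp [branchPhase]

variable {A G} {x₀ : {v // v ∈ A} → Fin 2}

theorem tildeVec_branch_graphState_eq_smul
    (hx₀ : crossAdj A G *ᵥ x₀ = evenDegreeVec (graphOff A G)) (x : {v // v ∈ A} → Fin 2) :
    tildeVec (branch A (graphState G) x) =
      branchPhase A G x₀ x • branch A (graphState G) (x + x₀) := by
  rw [tildeVec_branch_graphState, branch_graphState, Matrix.mulVec_add, hx₀, smul_smul,
    graphState_eq_bitSign_mul (graphOn A G) x (x + x₀), branchPhase,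
    AddChar.map_add_eq_mul bitSign (_ + _) (_ + _)]
  congr 1
  ring

theorem fidelity_reducedB_graphState_eq_one
    (hx₀ : crossAdj A G *ᵥ x₀ = evenDegreeVec (graphOff A G)) :
    fidelity (reducedB A (density (graphState G)))
      (tildeOp (reducedB A (density (graphState G)))) = 1 := by
  rw [reducedB_density, fidelity_tildeOp_sum_density_of_perm (Equiv.addRight x₀) _
    (norm_branchPhase A G x₀) (tildeVec_branch_graphState_eq_smul hx₀)]
  exact_mod_cast sum_norm_sq_branch_graphState A G

/-- The phase `i^b` of a bit. -/
def bitPhase (b : Fin 2) : ℂ := Complex.I ^ (b : ℕ)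

theorem star_bitPhase (b : Fin 2) : star (bitPhase b) = bitPhase b * bitSign b := by
  fin_cases b <;> simp [bitPhase, bitSign_one]

theorem star_bitPhase_mul_self (b : Fin 2) : star (bitPhase b) * bitPhase b = 1 := by
  fin_cases b <;> simp [bitPhase]

variable (A G) in
/-- A measurement basis adapted to `G`: the graph basis of `G[A]`, twisted by the phases
`i^{1ᵀ Γ_BA x}`. The twist absorbs the sign `(-1)^{1ᵀ Γ_BA x}` by which the tilde of the branch `x`
depends on `x`. -/
noncomputable def adaptedVec (u : {v // v ∈ A} → Fin 2) : Qubits {v // v ∈ A} :=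
  phaseFlip u <| WithLp.toLp 2 fun x =>
    bitPhase (1 ⬝ᵥ crossAdj A G *ᵥ x) * graphState (graphOn A G) x

variable (A G) in
theorem orthonormal_adaptedVec : Orthonormal ℂ (adaptedVec A G) :=
  orthonormal_phaseFlip fun x => by
    rw [star_mul', star_graphState, mul_mul_mul_comm, star_bitPhase_mul_self, one_mul,
      graphState_mul_self]

variable (A G) in
/-- The measurement on `A` in the basis `adaptedVec A G`. -/
noncomputable def adaptedMeasurement : Measurement A :=
  OrthonormalBasis.mk (orthonormal_adaptedVec A G)
    ((orthonormal_adaptedVec A G).linearIndependent.span_eq_top_of_card_eq_finrank' (by simp)).ge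

theorem adaptedVec_mul_branchPhase (hB : Even (Fintype.card {v // v ∉ A}))
    (hx₀ : crossAdj A G *ᵥ x₀ = evenDegreeVec (graphOff A G)) (u x : {v // v ∈ A} → Fin 2) :
    adaptedVec A G u x * branchPhase A G x₀ x =
      (-Complex.I) ^ Fintype.card {v // v ∉ A} *
        bitSign (edgeForm (graphOff A G) 1 + u ⬝ᵥ x₀) * star (adaptedVec A G u (x + x₀)) := by
  have hshift : 1 ⬝ᵥ crossAdj A G *ᵥ (x + x₀) = 1 ⬝ᵥ crossAdj A G *ᵥ x := by
    rw [Matrix.mulVec_add, hx₀, dotProduct_add, one_dotProduct_evenDegreeVec,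
      CharTwo.natCast_eq_ite, if_pos hB, add_zero]
  have hsign : bitSign (u ⬝ᵥ x) = bitSign (u ⬝ᵥ x₀) * bitSign (u ⬝ᵥ (x + x₀)) := by
    rw [dotProduct_add, AddChar.map_add_eq_mul, mul_left_comm, bitSign_mul_self, mul_one]
  simp only [adaptedVec, phaseFlip, branchPhase, hshift, hsign, AddChar.map_add_eq_mul,
    graphState_eq_bitSign_mul (graphOn A G) (x + x₀) x, star_mul', star_bitSign, star_graphState,
    star_bitPhase]
  ring

theorem tangle_postState_adaptedMeasurement (hB : Even (Fintype.card {v // v ∉ A}))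
    (hx₀ : crossAdj A G *ᵥ x₀ = evenDegreeVec (graphOff A G)) {u : {v // v ∈ A} → Fin 2}
    (hu : outcomeProb (adaptedMeasurement A G) (graphState G) u ≠ 0) :
    tangle (postState (adaptedMeasurement A G) (graphState G) u) = 1 := by
  have htilde : tildeVec (contractA A (adaptedVec A G u) (graphState G)) =
      ((-Complex.I) ^ Fintype.card {v // v ∉ A} *
        bitSign (edgeForm (graphOff A G) 1 + u ⬝ᵥ x₀)) •
        contractA A (adaptedVec A G u) (graphState G) := by
    rw [contractA_eq_sum_branch]
    refine tildeVec_sum_smul_of_perm (Equiv.addRight x₀)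
      (tildeVec_branch_graphState_eq_smul hx₀) fun x => ?_
    rw [star_star]
    exact adaptedVec_mul_branchPhase hB hx₀ u x
  have htangle : tangle (contractA A (adaptedMeasurement A G u) (graphState G)) =
      outcomeProb (adaptedMeasurement A G) (graphState G) u := by
    rw [outcomeProb, adaptedMeasurement, OrthonormalBasis.coe_mk]
    exact tangle_eq_norm_sq_of_tildeVec_eq_smul (by simp) htilde
  rw [tangle_postState, htangle, inv_mul_cancel₀ hu]

end Bipartite

end GraphTangle

open GraphTangle in
theorem mainTheorem2 {V : Type*} [Fintype V] [DecidableEq V]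
    (G : SimpleGraph V) [DecidableRel G.Adj] (A : Finset V)
    (hB : Even (Fintype.card {v // v ∉ A})) :
    -- the fidelity is `1` or `0` according to solvability of `Γ_BA x = D`
    ((∃ x : {v // v ∈ A} → ZMod 2, gammaBA G A *ᵥ x = degreeVec G A) →
      fidelity (reducedB A (density (graphState G)))
        (tildeOp (reducedB A (density (graphState G)))) = 1) ∧
    ((¬ ∃ x : {v // v ∈ A} → ZMod 2, gammaBA G A *ᵥ x = degreeVec G A) →
      fidelity (reducedB A (density (graphState G)))
        (tildeOp (reducedB A (density (graphState G)))) = 0) ∧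
    -- no solution: every measurement on `A` yields only `τ = 0` states
    ((¬ ∃ x : {v // v ∈ A} → ZMod 2, gammaBA G A *ᵥ x = degreeVec G A) →
      ∀ (M : Measurement A) (i : {v // v ∈ A} → Fin 2),
        outcomeProb M (graphState G) i ≠ 0 → tangle (postState M (graphState G) i) = 0) ∧
    -- a solution: some measurement on `A` yields only `τ = 1` states
    ((∃ x : {v // v ∈ A} → ZMod 2, gammaBA G A *ᵥ x = degreeVec G A) →
      ∃ M : Measurement A, ∀ i : {v // v ∈ A} → Fin 2,
        outcomeProb M (graphState G) i ≠ 0 → tangle (postState M (graphState G) i) = 1) := by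
  rw [exists_gammaBA_mulVec_eq_degreeVec_iff]
  refine ⟨?_, fidelity_reducedB_graphState_eq_zero A G, ?_, ?_⟩
  · rintro ⟨x₀, hx₀⟩
    exact fidelity_reducedB_graphState_eq_one hx₀
  · intro h M i _
    exact tangle_postState_graphState_eq_zero A G h M i
  · rintro ⟨x₀, hx₀⟩
    exact ⟨adaptedMeasurement A G, fun _ hp => tangle_postState_adaptedMeasurement hB hx₀ hp⟩
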